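/- Let $p,q\ge 0$ be integers, $\mu_1,\mu_2\in\mathbb R$ and $\beta=(\beta_1,\dots,\beta_{p+q})^t\in\mathbb R^{p+q}$. On a probability space let $x_{i,j}$ ($i\ge 1$, $1\le j\le p+q$) be mutually independent real random variables such that, for each $j$, every $x_{i,j}$ has the distribution of a random variable $X_j$ with $\mathbb E X_j=0$ and $\mathbb E X_j^2<\infty$, and suppose that $\mathrm{Var}(X_j)>0$ for $1\le j\le p$. Let $\epsilon_1,\epsilon_2,\dots$ be i.i.d. with mean zero and finite variance. For each $n$ let $T_{n,1},\dots,T_{n,n}$ be $\{0,1\}$-valued random variables (the treatment assignments of the first $n$ units; write $T_i=T_{n,i}$), which may depend on the covariates. Assume that the family $(\epsilon_i)_i$ is independent of $(x_{i,j})_{i,j}$ and that, for each $n$, $(\epsilon_1,\dots,\epsilon_n)$ is independent of $(T_{n,1},\dots,T_{n,n})$. The outcomes are $$Y_i=\mu_1T_i+\mu_2(1-T_i)+\sum_{j=1}^{p+q}\beta_jx_{i,j}+\epsilon_i,\qquad i=1,\dots,n .$$ Put $\mathbf x_i=(x_{i,1},\dots,x_{i,p+q})^t$, $\mathbf X_{\rm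 in}=(x_{i,j})_{i\le n,\,j\le p}$, $\mathbf X_{\rm ex}=(x_{i,p+j})_{i\le n,\,j\le q}$, $\mathbf T=(T_1,\dots,T_n)^t$, $\mathbf Y=(Y_1,\dots,Y_n)^t$, $\boldsymbol\epsilon=(\epsilon_1,\dots,\epsilon_n)^t$, $\beta_{\rm ex}=(\beta_{p+1},\dots,\beta_{p+q})^t$ and $\theta=(\mu_1,\mu_2,\beta_1,\dots,\beta_p)^t$. The working model uses only the first $p$ covariates: its design matrix is $\mathbf G=[\mathbf T;\ \mathbf 1_n-\mathbf T;\ \mathbf X_{\rm in}]$ (listed by blocks of columns), and its ordinary least squares estimator is $\hat\theta=(\mathbf G^t\mathbf G)^{-1}\mathbf G^t\mathbf Y$ (where $\mathbf G^t\mathbf G$ is singular, $\hat\theta$ is set to $0$). Assume 1. (global balance) $n^{-1}\sum_{i=1}^n(2T_i-1)\to 0$ in probability; 2. (covariate balance) $n^{-1/2}\sum_{i=1}^n(2T_i-1)\mathbf x_i\to\xi$ in distribution, where $\xi$ is a $(p+q)$-dimensional random vector with $\mathbb E\xi=0$. Then, as $n\to\infty$, $\mathbf G^t\mathbf G$ is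 invertible with probability tending to one, $\hat\theta$ is consistent, i.e. $\hat\theta\to\theta$ in probability, and $$\sqrt n(\hat\theta-\theta)=\frac1{\sqrt n}\,\mathbf V^{-1}\mathbf G^t(\mathbf X_{\rm ex}\beta_{\rm ex}+\boldsymbol\epsilon)+o_P(1),\qquad \mathbf V=\mathrm{diag}\bigl(\tfrac12,\tfrac12,\mathrm{Var}(X_1),\dots,\mathrm{Var}(X_p)\bigr).$$ -/

import Mathlib

open MeasureTheory ProbabilityTheory Filter Topology
open scoped Matrix

/-- The design matrix `G = [T; 1 - T; X_in]` of the working model with `n` units: the first two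
columns are the two treatment indicators, the others are the first `p` of the `p + q` covariates. -/
def designMatrix {Ω : Type*} {p q : ℕ} (T : (n : ℕ) → Fin n → Ω → ℝ)
    (x : ℕ → Fin (p + q) → Ω → ℝ) (n : ℕ) (ω : Ω) : Matrix (Fin n) (Fin 2 ⊕ Fin p) ℝ :=
  Matrix.of fun i => Sum.elim ![T n i ω, 1 - T n i ω] fun j => x i (Fin.castAdd q j) ω

/-- The matrix `X_ex` of the last `q` covariates, which the working model leaves out. -/
def excludedCovariates {Ω : Type*} {p q : ℕ} (x : ℕ → Fin (p + q) → Ω → ℝ) (n : ℕ) (ω : Ω) :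
    Matrix (Fin n) (Fin q) ℝ :=
  Matrix.of fun i j => x i (Fin.natAdd p j) ω

/-- The outcomes `Y` of `n` units under the true linear model, with all `p + q` covariates. -/
def outcome {Ω : Type*} {p q : ℕ} (μ₁ μ₂ : ℝ) (β : Fin (p + q) → ℝ)
    (T : (n : ℕ) → Fin n → Ω → ℝ) (x : ℕ → Fin (p + q) → Ω → ℝ) (ε : ℕ → Ω → ℝ)
    (n : ℕ) (ω : Ω) : Fin n → ℝ :=
  fun i => μ₁ * T n i ω + μ₂ * (1 - T n i ω) + ∑ j, β j * x i j ω + ε i ω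

/-- The parameter `θ = (μ₁, μ₂, β₁, …, β_p)` of the working model. -/
def workingParameter {p q : ℕ} (μ₁ μ₂ : ℝ) (β : Fin (p + q) → ℝ) : Fin 2 ⊕ Fin p → ℝ :=
  Sum.elim ![μ₁, μ₂] fun j => β (Fin.castAdd q j)

/-- The coefficients `β_ex = (β_{p+1}, …, β_{p+q})` of the excluded covariates. -/
def excludedCoefficients {p q : ℕ} (β : Fin (p + q) → ℝ) : Fin q → ℝ :=
  fun j => β (Fin.natAdd p j)

/-- The ordinary least squares estimate `(GᵗG)⁻¹ Gᵗ Y`. -/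
noncomputable def olsEstimate {n p : ℕ} (G : Matrix (Fin n) (Fin 2 ⊕ Fin p) ℝ) (Y : Fin n → ℝ) :
    Fin 2 ⊕ Fin p → ℝ :=
  (Gᵀ * G)⁻¹ *ᵥ (Gᵀ *ᵥ Y)

/-- The matrix `V = diag(1/2, 1/2, Var X₁, …, Var X_p)`. -/
noncomputable def limitMatrix {Ω : Type*} [MeasurableSpace Ω] {p q : ℕ} (P : Measure Ω)
    (X : Fin (p + q) → Ω → ℝ) : Matrix (Fin 2 ⊕ Fin p) (Fin 2 ⊕ Fin p) ℝ :=
  Matrix.diagonal (Sum.elim (fun _ => 1 / 2) fun j => variance (X (Fin.castAdd q j)) P)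

/-!
Balance makes the treatment indicators asymptotically orthogonal to the covariates: the identities
`T y = ((2T - 1) y + y) / 2` and `(1 - T) y = y - T y` turn the `O_P(√n)` bound on the imbalance
into the same bound on the sums of each covariate over either treatment arm. Products of distinct
covariates, and of a regressor with the error, are orthogonal families in `L²`, so their sums are
`O_P(√n)` as well. Therefore `n⁻¹ GᵀG → V` in probability and the score `n^{-1/2} Gᵀu`, where
`u = X_ex β_ex + ε`, is `O_P(1)`. Where `GᵀG` is invertible,
`√n (θ̂ - θ) = (n⁻¹ GᵀG)⁻¹ (n^{-1/2} Gᵀu)`, and replacing `(n⁻¹ GᵀG)⁻¹` by `V⁻¹` costs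
`o_P(1) O_P(1) = o_P(1)`.
-/

section HighProbability

variable {Ω ι E F H : Type*} [MeasurableSpace Ω] {P : Measure Ω} {l : Filter ι}

/-- The filter on `ι × Ω` of events that hold with probability tending to one along `l`: the
probability of failing at index `n` tends to zero. Limits along this filter are limits in
probability, so that the calculus of limits along filters applies to them. -/
def highProbability (P : Measure Ω) (l : Filter ι) : Filter (ι × Ω) :=
  comk (fun S => Tendsto (fun n => P (Prod.mk n ⁻¹' S)) l (𝓝 0))
    (by simp [tendsto_const_nhds])
    (fun _ hS _ hle => tendsto_of_tendsto_of_tendsto_of_le_of_le tendsto_const_nhds hS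
      (fun _ => zero_le) fun _ => measure_mono (Set.preimage_mono hle))
    (fun _ hS _ hR => tendsto_of_tendsto_of_tendsto_of_le_of_le tendsto_const_nhds
      (add_zero (0 : ENNReal) ▸ hS.add hR) (fun _ => zero_le)
      fun _ => measure_union_le _ _)

theorem eventually_highProbability {p : ι → Ω → Prop} :
    (∀ᶠ z in highProbability P l, p z.1 z.2) ↔ Tendsto (fun n => P {ω | ¬ p n ω}) l (𝓝 0) :=
  Iff.rfl

theorem tendsto_fst_highProbability : Tendsto Prod.fst (highProbability P l) l := by
  intro s hs
  refine eventually_highProbability (p := fun n _ => n ∈ s) |>.2 (tendsto_const_nhds.congr' ?_)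
  filter_upwards [hs] with n hn
  simp [hn]

theorem tendstoInMeasure_const_iff [PseudoEMetricSpace E] {f : ι → Ω → E} {c : E} :
    TendstoInMeasure P f l (fun _ => c) ↔
      Tendsto (fun z : ι × Ω => f z.1 z.2) (highProbability P l) (𝓝 c) := by
  simp only [EMetric.tendsto_nhds, TendstoInMeasure]
  refine forall₂_congr fun η _ => ?_
  rw [eventually_highProbability (p := fun n ω => edist (f n ω) c < η)]
  simp only [not_lt]

theorem tendsto_measure_of_eventually_highProbability [IsProbabilityMeasure P] {p : ι → Ω → Prop}
    (h : ∀ᶠ z in highProbability P l, p z.1 z.2) :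
    Tendsto (fun n => P {ω | p n ω}) l (𝓝 1) := by
  have hlow : Tendsto (fun n => 1 - P {ω | ¬ p n ω}) l (𝓝 1) := by
    simpa only [tsub_zero] using ENNReal.Tendsto.sub tendsto_const_nhds
      (eventually_highProbability.1 h) (.inl ENNReal.one_ne_top)
  refine tendsto_of_tendsto_of_tendsto_of_le_of_le hlow tendsto_const_nhds (fun n => ?_)
    fun n => prob_le_one
  rw [tsub_le_iff_right, ← measure_univ (μ := P), ← Set.union_compl_self {ω | p n ω}]
  exact measure_union_le _ _

/-- Boundedness in probability, `f n = O_P(1)` along `l`. -/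
def BoundedInProbability [Norm E] (P : Measure Ω) (l : Filter ι) (f : ι → Ω → E) : Prop :=
  ∀ δ : ENNReal, 0 < δ → ∃ M : ℝ, ∀ᶠ n in l, P {ω | M ≤ ‖f n ω‖} ≤ δ

namespace BoundedInProbability

section Seminormed

variable [SeminormedAddCommGroup E] [SeminormedAddCommGroup F] [SeminormedAddCommGroup H]

theorem of_norm_le_const_mul {f : ι → Ω → E} {g : ι → Ω → F} (hg : BoundedInProbability P l g)
    (c : ℝ) (h : ∀ n ω, ‖f n ω‖ ≤ c * ‖g n ω‖) : BoundedInProbability P l f := by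
  intro δ hδ
  obtain ⟨M, hM⟩ := hg δ hδ
  refine ⟨(|c| + 1) * M, hM.mono fun n hn => (measure_mono fun ω hω => ?_).trans hn⟩
  simp only [Set.mem_ofPred_eq] at hω ⊢
  by_contra! hlt
  have hc : c * ‖g n ω‖ ≤ |c| * M := by gcongr; exact le_abs_self c
  linarith [h n ω, norm_nonneg (g n ω)]

theorem const_mul {f : ι → Ω → ℝ} (hf : BoundedInProbability P l f) (c : ℝ) :
    BoundedInProbability P l fun n ω => c * f n ω :=
  hf.of_norm_le_const_mul |c| fun n ω => (norm_mul c (f n ω)).le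

theorem add {f g : ι → Ω → E} (hf : BoundedInProbability P l f) (hg : BoundedInProbability P l g) :
    BoundedInProbability P l fun n ω => f n ω + g n ω := by
  intro δ hδ
  obtain ⟨M, hM⟩ := hf _ (ENNReal.half_pos hδ.ne')
  obtain ⟨N, hN⟩ := hg _ (ENNReal.half_pos hδ.ne')
  refine ⟨M + N, ?_⟩
  filter_upwards [hM, hN] with n hMn hNn
  rw [← ENNReal.add_halves δ]
  refine ((measure_mono fun ω hω => ?_).trans (measure_union_le _ _)).trans (add_le_add hMn hNn)
  by_contra hlt
  simp only [Set.mem_union, Set.mem_ofPred_eq, not_or, not_le] at hlt hω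
  linarith [norm_add_le (f n ω) (g n ω)]

theorem zero : BoundedInProbability P l fun _ _ => (0 : E) :=
  fun δ _ => ⟨1, .of_forall fun _ => by simp [not_le.2 (one_pos (α := ℝ))]⟩

theorem sum {κ : Type*} (s : Finset κ) {f : κ → ι → Ω → E}
    (h : ∀ k ∈ s, BoundedInProbability P l (f k)) :
    BoundedInProbability P l fun n ω => ∑ k ∈ s, f k n ω := by
  classical
  induction s using Finset.induction_on with
  | empty => simpa only [Finset.sum_empty] using zero
  | insert k s hk ih =>
    simpa only [Finset.sum_insert hk] using
      (h k (Finset.mem_insert_self k s)).add (ih fun i hi => h i (Finset.mem_insert_of_mem hi))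

theorem pi {κ : Type*} [Fintype κ] {f : ι → Ω → κ → E}
    (h : ∀ k, BoundedInProbability P l fun n ω => f n ω k) : BoundedInProbability P l f := by
  have hsum : BoundedInProbability P l fun n ω => ∑ k, ‖f n ω k‖ :=
    sum Finset.univ fun k _ => (h k).of_norm_le_const_mul 1 fun n ω => by
      rw [norm_norm, one_mul]
  refine hsum.of_norm_le_const_mul 1 fun n ω => ?_
  rw [one_mul, Real.norm_of_nonneg (by positivity), pi_norm_le_iff_of_nonneg (by positivity)]
  exact fun k => Finset.single_le_sum (fun k _ => norm_nonneg (f n ω k)) (Finset.mem_univ k)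

theorem apply {κ : Type*} [Fintype κ] {f : ι → Ω → κ → E} (h : BoundedInProbability P l f)
    (k : κ) : BoundedInProbability P l fun n ω => f n ω k :=
  h.of_norm_le_const_mul 1 fun n ω => by rw [one_mul]; exact norm_le_pi_norm (f n ω) k

theorem tendsto_zero_of_norm_le_mul {f : ι → Ω → E} {g : ι → Ω → F} {h : ι → Ω → H}
    (hg : BoundedInProbability P l g)
    (hf : Tendsto (fun z : ι × Ω => f z.1 z.2) (highProbability P l) (𝓝 0))
    (hle : ∀ n ω, ‖h n ω‖ ≤ ‖f n ω‖ * ‖g n ω‖) :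
    Tendsto (fun z : ι × Ω => h z.1 z.2) (highProbability P l) (𝓝 0) := by
  refine NormedAddGroup.tendsto_nhds_zero.2 fun η hη =>
    (eventually_highProbability (p := fun n ω => ‖h n ω‖ < η)).2
      (ENNReal.tendsto_nhds_zero.2 fun δ hδ => ?_)
  obtain ⟨M, hM⟩ := hg _ (ENNReal.half_pos hδ.ne')
  have hη' : 0 < η / (|M| + 1) := by positivity
  have hsmall : ∀ᶠ n in l, P {ω | ¬ ‖f n ω‖ < η / (|M| + 1)} ≤ δ / 2 :=
    (eventually_highProbability (p := fun n ω => ‖f n ω‖ < η / (|M| + 1)) |>.1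
      (NormedAddGroup.tendsto_nhds_zero.1 hf _ hη')).eventually_le_const
        (ENNReal.half_pos hδ.ne')
  filter_upwards [hsmall, hM] with n hfn hgn
  have hsub : {ω | ¬ ‖h n ω‖ < η} ⊆ {ω | ¬ ‖f n ω‖ < η / (|M| + 1)} ∪ {ω | M ≤ ‖g n ω‖} := by
    intro ω hω
    by_contra hlt
    simp only [Set.mem_union, Set.mem_ofPred_eq, not_or, not_not, not_le] at hlt hω
    have hgM : ‖g n ω‖ ≤ |M| + 1 := by linarith [hlt.2, le_abs_self M]
    exact hω (calc
      ‖h n ω‖ ≤ ‖f n ω‖ * ‖g n ω‖ := hle n ω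
      _ ≤ ‖f n ω‖ * (|M| + 1) := mul_le_mul_of_nonneg_left hgM (norm_nonneg _)
      _ < η := (lt_div_iff₀ (by positivity)).1 hlt.1)
  calc P {ω | ¬ ‖h n ω‖ < η}
      ≤ P {ω | ¬ ‖f n ω‖ < η / (|M| + 1)} + P {ω | M ≤ ‖g n ω‖} :=
        (measure_mono hsub).trans (measure_union_le _ _)
    _ ≤ δ / 2 + δ / 2 := add_le_add hfn hgn
    _ = δ := ENNReal.add_halves δ

theorem of_integral_norm_sq_le [IsFiniteMeasure P] {f : ι → Ω → E} {C : ℝ}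
    (hf : ∀ n, Integrable (fun ω => ‖f n ω‖ ^ 2) P)
    (hC : ∀ᶠ n in l, ∫ ω, ‖f n ω‖ ^ 2 ∂P ≤ C) : BoundedInProbability P l f := by
  intro δ hδ
  have hlim : Tendsto (fun M : ℝ => ENNReal.ofReal (C / M ^ 2)) atTop (𝓝 0) := by
    rw [← ENNReal.ofReal_zero]
    exact ENNReal.tendsto_ofReal (tendsto_const_nhds.div_atTop (tendsto_pow_atTop two_ne_zero))
  obtain ⟨M, hMδ, hM⟩ := ((hlim.eventually_le_const hδ).and (eventually_gt_atTop 0)).exists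
  refine ⟨M, hC.mono fun n hn => le_trans ?_ hMδ⟩
  have hmarkov : M ^ 2 * P.real {ω | M ^ 2 ≤ ‖f n ω‖ ^ 2} ≤ C :=
    (mul_meas_ge_le_integral_of_nonneg (.of_forall fun ω => sq_nonneg _) (hf n) _).trans hn
  simp only [pow_le_pow_iff_left₀ hM.le (norm_nonneg _) two_ne_zero] at hmarkov
  rw [← ofReal_measureReal]
  exact ENNReal.ofReal_le_ofReal ((le_div_iff₀' (by positivity)).2 hmarkov)

end Seminormed

end BoundedInProbability

theorem tendsto_measure_le_norm_atTop [SeminormedAddCommGroup E] [MeasurableSpace E]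
    [OpensMeasurableSpace E] (μ : Measure E) [IsFiniteMeasure μ] :
    Tendsto (fun M : ℝ => μ {y | M ≤ ‖y‖}) atTop (𝓝 0) := by
  have hempty : ⋂ M : ℝ, {y : E | M ≤ ‖y‖} = ∅ := by
    refine Set.eq_empty_of_forall_notMem fun y hy => ?_
    have hlt : ‖y‖ + 1 ≤ ‖y‖ := Set.mem_iInter.1 hy (‖y‖ + 1)
    linarith
  rw [← measure_empty (μ := μ), ← hempty]
  exact tendsto_measure_iInter_atTop
    (fun M => (isClosed_le continuous_const continuous_norm).measurableSet.nullMeasurableSet)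
    (fun _ _ hle _ hy => hle.trans hy) ⟨0, measure_ne_top _ _⟩

theorem BoundedInProbability.of_tendstoInDistribution {Ω' : Type*} [MeasurableSpace Ω']
    {P' : Measure Ω'} [IsProbabilityMeasure P] [IsProbabilityMeasure P'] [SeminormedAddCommGroup E]
    [MeasurableSpace E] [OpensMeasurableSpace E] {f : ι → Ω → E} {ξ : Ω' → E}
    (h : TendstoInDistribution f l ξ (fun _ => P) P') : BoundedInProbability P l f := by
  intro δ hδ
  have : IsProbabilityMeasure (P'.map ξ) := Measure.isProbabilityMeasure_map h.aemeasurable_limit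
  obtain ⟨M, hM⟩ := ((tendsto_measure_le_norm_atTop (P'.map ξ)).eventually_lt_const hδ).exists
  have hclosed : IsClosed {y : E | M ≤ ‖y‖} := isClosed_le continuous_const continuous_norm
  refine ⟨M, ?_⟩
  have hportmanteau := ProbabilityMeasure.limsup_measure_closed_le_of_tendsto h.tendsto hclosed
  filter_upwards [eventually_lt_of_limsup_lt (hportmanteau.trans_lt hM)] with n hn
  simp only [ProbabilityMeasure.coe_mk] at hn
  rw [Measure.map_apply_of_aemeasurable (h.forall_aemeasurable n) hclosed.measurableSet] at hn
  exact hn.le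

theorem tendstoInMeasure_average {z : ℕ → Ω → ℝ} {Y : Ω → ℝ} [IsFiniteMeasure P]
    (hY : Integrable Y P) (hident : ∀ i, IdentDistrib (z i) Y P P)
    (hindep : Pairwise fun i k => IndepFun (z i) (z k) P) :
    TendstoInMeasure P (fun (n : ℕ) ω => (n : ℝ)⁻¹ * ∑ i : Fin n, z i ω) atTop
      fun _ => ∫ ω, Y ω ∂P := by
  have hz : ∀ i, Integrable (z i) P := fun i => (hident i).integrable_iff.2 hY
  refine tendstoInMeasure_of_tendsto_ae (fun n => ?_) ?_
  · exact (integrable_finsetSum _ fun (i : Fin n) _ => hz i).1.const_mul _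
  · filter_upwards [strong_law_ae_real z (hz 0) hindep
      fun i => (hident i).trans (hident 0).symm] with ω hω
    rw [(hident 0).integral_eq] at hω
    refine hω.congr fun n => ?_
    rw [div_eq_inv_mul, Finset.sum_range]

end HighProbability

section LeastSquares

variable {Ω κ : Type*} [MeasurableSpace Ω] {P : Measure Ω} [Fintype κ]

theorem BoundedInProbability.tendsto_mulVec_zero {ι m : Type*} {l : Filter ι}
    {M : ι → Ω → Matrix m κ ℝ} {Z : ι → Ω → κ → ℝ} (hZ : BoundedInProbability P l Z)
    (hM : Tendsto (fun z : ι × Ω => M z.1 z.2) (highProbability P l) (𝓝 0)) :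
    Tendsto (fun z : ι × Ω => M z.1 z.2 *ᵥ Z z.1 z.2) (highProbability P l) (𝓝 0) := by
  refine tendsto_pi_nhds.2 fun a => ?_
  have hentry : ∀ b, Tendsto (fun z : ι × Ω => M z.1 z.2 a b) (highProbability P l) (𝓝 0) :=
    fun b => tendsto_pi_nhds.1 (tendsto_pi_nhds.1 hM a) b
  have hterm : ∀ b, Tendsto (fun z : ι × Ω => M z.1 z.2 a b * Z z.1 z.2 b)
      (highProbability P l) (𝓝 0) := fun b =>
    (hZ.apply b).tendsto_zero_of_norm_le_mul (f := fun n ω => M n ω a b)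
      (h := fun n ω => M n ω a b * Z n ω b) (hentry b) fun _ _ => norm_mul_le _ _
  simpa only [Matrix.mulVec, dotProduct, Pi.zero_apply, Finset.sum_const_zero] using
    tendsto_finsetSum Finset.univ fun b _ => hterm b

variable [DecidableEq κ]

theorem leastSquares_sub_eq {m R : Type*} [Fintype m] [CommRing R] {G : Matrix m κ R}
    (hG : IsUnit (Gᵀ * G)) (θ : κ → R) (u : m → R) :
    (Gᵀ * G)⁻¹ *ᵥ (Gᵀ *ᵥ (G *ᵥ θ + u)) - θ = (Gᵀ * G)⁻¹ *ᵥ (Gᵀ *ᵥ u) := by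
  have hdet : IsUnit (Gᵀ * G).det := (Matrix.isUnit_iff_isUnit_det _).1 hG
  simp only [Matrix.mulVec_add, Matrix.mulVec_mulVec]
  rw [Matrix.nonsing_inv_mul _ hdet, Matrix.one_mulVec, add_sub_cancel_left]

theorem inv_mulVec_eq_scaled {A : Matrix κ κ ℝ} (hA : IsUnit A) {n : ℕ} (hn : n ≠ 0) (v : κ → ℝ) :
    A⁻¹ *ᵥ v = ((√(n : ℝ))⁻¹ • ((n : ℝ)⁻¹ • A)⁻¹) *ᵥ ((√(n : ℝ))⁻¹ • v) := by
  have hn' : (0 : ℝ) < n := by positivity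
  have hinv : ((n : ℝ)⁻¹ • A)⁻¹ = (n : ℝ) • A⁻¹ := by
    refine Matrix.inv_eq_right_inv ?_
    rw [Matrix.smul_mul, Matrix.mul_smul,
      Matrix.mul_nonsing_inv _ ((Matrix.isUnit_iff_isUnit_det _).1 hA), smul_smul,
      inv_mul_cancel₀ hn'.ne', one_smul]
  have hscale : (√(n : ℝ))⁻¹ * (√(n : ℝ))⁻¹ * n = 1 := by
    rw [← mul_inv, Real.mul_self_sqrt hn'.le, inv_mul_cancel₀ hn'.ne']
  rw [hinv, Matrix.mulVec_smul, Matrix.smul_mulVec, Matrix.smul_mulVec, smul_smul, smul_smul,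
    hscale, one_smul]

theorem tendsto_inv_sqrt_natCast : Tendsto (fun n : ℕ => (√(n : ℝ))⁻¹) atTop (𝓝 0) :=
  tendsto_inv_atTop_zero.comp (Real.tendsto_sqrt_atTop.comp tendsto_natCast_atTop_atTop)

theorem continuousAt_inv_of_isUnit {K : Type*} [Field K] [TopologicalSpace K] [IsTopologicalRing K]
    [ContinuousInv₀ K] {V : Matrix κ κ K} (hV : IsUnit V) :
    ContinuousAt (fun M : Matrix κ κ K => M⁻¹) V := by
  refine continuousAt_matrix_inv V ?_
  rw [Ring.inverse_eq_inv']
  exact continuousAt_inv₀ ((Matrix.isUnit_iff_isUnit_det V).1 hV).ne_zero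

variable {G : (n : ℕ) → Ω → Matrix (Fin n) κ ℝ} {u : (n : ℕ) → Ω → Fin n → ℝ} {V : Matrix κ κ ℝ}

theorem eventually_isUnit_gram (hV : IsUnit V)
    (hGram : Tendsto (fun z : ℕ × Ω => (z.1 : ℝ)⁻¹ • ((G z.1 z.2)ᵀ * G z.1 z.2))
      (highProbability P atTop) (𝓝 V)) :
    ∀ᶠ z in highProbability P atTop, IsUnit ((G z.1 z.2)ᵀ * G z.1 z.2) := by
  have hdet : ∀ᶠ M in 𝓝 V, M.det ≠ 0 :=
    continuous_id.matrix_det.continuousAt.eventually_ne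
      ((Matrix.isUnit_iff_isUnit_det V).1 hV).ne_zero
  filter_upwards [hGram.eventually hdet] with z hz
  rw [Matrix.det_smul] at hz
  exact (Matrix.isUnit_iff_isUnit_det _).2 (right_ne_zero_of_mul hz).isUnit

theorem tendsto_leastSquares (hV : IsUnit V)
    (hGram : Tendsto (fun z : ℕ × Ω => (z.1 : ℝ)⁻¹ • ((G z.1 z.2)ᵀ * G z.1 z.2))
      (highProbability P atTop) (𝓝 V))
    (hscore : BoundedInProbability P atTop
      fun (n : ℕ) ω => (√(n : ℝ))⁻¹ • ((G n ω)ᵀ *ᵥ u n ω)) (θ : κ → ℝ) :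
    Tendsto (fun z : ℕ × Ω => ((G z.1 z.2)ᵀ * G z.1 z.2)⁻¹ *ᵥ
        ((G z.1 z.2)ᵀ *ᵥ (G z.1 z.2 *ᵥ θ + u z.1 z.2))) (highProbability P atTop) (𝓝 θ) := by
  have hcoeff : Tendsto (fun z : ℕ × Ω =>
      (√(z.1 : ℝ))⁻¹ • ((z.1 : ℝ)⁻¹ • ((G z.1 z.2)ᵀ * G z.1 z.2))⁻¹)
      (highProbability P atTop) (𝓝 0) := by
    simpa only [zero_smul, Function.comp_def] using
      (tendsto_inv_sqrt_natCast.comp tendsto_fst_highProbability).smul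
        ((continuousAt_inv_of_isUnit hV).tendsto.comp hGram)
  refine tendsto_sub_nhds_zero_iff.1 ((hscore.tendsto_mulVec_zero
    (M := fun (n : ℕ) ω => (√(n : ℝ))⁻¹ • ((n : ℝ)⁻¹ • ((G n ω)ᵀ * G n ω))⁻¹) hcoeff).congr' ?_)
  filter_upwards [eventually_isUnit_gram hV hGram,
    tendsto_fst_highProbability.eventually (eventually_ne_atTop 0)] with z hz hn
  rw [leastSquares_sub_eq hz, ← inv_mulVec_eq_scaled hz hn]

theorem tendsto_leastSquares_remainder (hV : IsUnit V)
    (hGram : Tendsto (fun z : ℕ × Ω => (z.1 : ℝ)⁻¹ • ((G z.1 z.2)ᵀ * G z.1 z.2))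
      (highProbability P atTop) (𝓝 V))
    (hscore : BoundedInProbability P atTop
      fun (n : ℕ) ω => (√(n : ℝ))⁻¹ • ((G n ω)ᵀ *ᵥ u n ω)) (θ : κ → ℝ) :
    Tendsto (fun z : ℕ × Ω => √(z.1 : ℝ) • (((G z.1 z.2)ᵀ * G z.1 z.2)⁻¹ *ᵥ
          ((G z.1 z.2)ᵀ *ᵥ (G z.1 z.2 *ᵥ θ + u z.1 z.2)) - θ) -
        (√(z.1 : ℝ))⁻¹ • (V⁻¹ *ᵥ ((G z.1 z.2)ᵀ *ᵥ u z.1 z.2)))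
      (highProbability P atTop) (𝓝 0) := by
  have hcoeff : Tendsto (fun z : ℕ × Ω =>
      ((z.1 : ℝ)⁻¹ • ((G z.1 z.2)ᵀ * G z.1 z.2))⁻¹ - V⁻¹) (highProbability P atTop) (𝓝 0) :=
    tendsto_sub_nhds_zero_iff.2 ((continuousAt_inv_of_isUnit hV).tendsto.comp hGram)
  refine (hscore.tendsto_mulVec_zero
    (M := fun (n : ℕ) ω => ((n : ℝ)⁻¹ • ((G n ω)ᵀ * G n ω))⁻¹ - V⁻¹) hcoeff).congr' ?_
  filter_upwards [eventually_isUnit_gram hV hGram,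
    tendsto_fst_highProbability.eventually (eventually_ne_atTop 0)] with z hz hn
  have hs : √(z.1 : ℝ) ≠ 0 := by positivity
  rw [leastSquares_sub_eq hz, inv_mulVec_eq_scaled hz hn, Matrix.smul_mulVec, smul_inv_smul₀ hs,
    Matrix.sub_mulVec, Matrix.mulVec_smul V⁻¹]

end LeastSquares

section Orthogonal

variable {Ω ι : Type*} [MeasurableSpace Ω] {P : Measure Ω} {z w : ι → Ω → ℝ} {C D : ℝ}

/-- A family of pairwise orthogonal elements of `L²(P)` with second moments at most `C`. -/
structure IsBoundedOrthogonal (P : Measure Ω) (z : ι → Ω → ℝ) (C : ℝ) : Prop where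
  memLp : ∀ i, MemLp (z i) 2 P
  integral_sq_le : ∀ i, ∫ ω, z i ω ^ 2 ∂P ≤ C
  orthogonal : Pairwise fun i k => ∫ ω, z i ω * z k ω ∂P = 0

theorem integral_mul_sq_of_indepFun {f g : Ω → ℝ} (h : IndepFun f g P)
    (hf : AEStronglyMeasurable f P) (hg : AEStronglyMeasurable g P) :
    ∫ ω, (f ω * g ω) ^ 2 ∂P = (∫ ω, f ω ^ 2 ∂P) * ∫ ω, g ω ^ 2 ∂P := by
  simp_rw [mul_pow]
  exact (h.comp (measurable_id.pow_const 2) (measurable_id.pow_const 2)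
    ).integral_fun_mul_eq_mul_integral (hf.pow 2) (hg.pow 2)

theorem memLp_two_mul_of_indepFun {f g : Ω → ℝ} (h : IndepFun f g P) (hf : MemLp f 2 P)
    (hg : MemLp g 2 P) : MemLp (fun ω => f ω * g ω) 2 P := by
  refine (memLp_two_iff_integrable_sq (hf.1.mul hg.1)).2 ?_
  simp only [Pi.mul_apply, mul_pow]
  exact (h.comp (measurable_id.pow_const 2) (measurable_id.pow_const 2)
    ).integrable_mul hf.integrable_sq hg.integrable_sq

namespace IsBoundedOrthogonal

theorem of_identDistrib {Y : Ω → ℝ} (hindep : Pairwise fun i k => IndepFun (z i) (z k) P)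
    (hident : ∀ i, IdentDistrib (z i) Y P P) (hY : MemLp Y 2 P) (hmean : ∫ ω, Y ω ∂P = 0) :
    IsBoundedOrthogonal P z (variance Y P) where
  memLp i := (hident i).memLp_iff.2 hY
  integral_sq_le i := by
    rw [variance_of_integral_eq_zero hY.1.aemeasurable hmean]
    exact (hident i).sq.integral_eq.le
  orthogonal i k hik := by
    beta_reduce
    rw [(hindep hik).integral_fun_mul_eq_mul_integral ((hident i).memLp_iff.2 hY).1
      ((hident k).memLp_iff.2 hY).1, (hident i).integral_eq, hmean, zero_mul]

theorem comp_injective {κ : Type*} (hz : IsBoundedOrthogonal P z C) {e : κ → ι}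
    (he : e.Injective) : IsBoundedOrthogonal P (fun k => z (e k)) C where
  memLp k := hz.memLp (e k)
  integral_sq_le k := hz.integral_sq_le (e k)
  orthogonal := hz.orthogonal.comp_of_injective he

theorem mul_of_indepFun (hz : IsBoundedOrthogonal P z C) (hw : ∀ i, MemLp (w i) 2 P)
    (hw_sq : ∀ i, ∫ ω, w i ω ^ 2 ∂P ≤ D)
    (hindep : IndepFun (fun ω i => z i ω) (fun ω i => w i ω) P) :
    IsBoundedOrthogonal P (fun i ω => w i ω * z i ω) (D * C) := by
  have hpair : ∀ i, IndepFun (w i) (z i) P := fun i =>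
    (hindep.comp (measurable_pi_apply i) (measurable_pi_apply i)).symm
  refine ⟨fun i => memLp_two_mul_of_indepFun (hpair i) (hw i) (hz.memLp i), fun i => ?_,
    fun i k hik => ?_⟩
  · rw [integral_mul_sq_of_indepFun (hpair i) (hw i).1 (hz.memLp i).1]
    exact mul_le_mul (hw_sq i) (hz.integral_sq_le i) (integral_nonneg fun ω => sq_nonneg _)
      ((integral_nonneg fun ω => sq_nonneg _).trans (hw_sq i))
  · have hprod : IndepFun (fun ω => w i ω * w k ω) (fun ω => z i ω * z k ω) P :=
      (hindep.comp (φ := fun v : ι → ℝ => v i * v k) (ψ := fun v : ι → ℝ => v i * v k)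
        (by fun_prop) (by fun_prop)).symm
    calc ∫ ω, w i ω * z i ω * (w k ω * z k ω) ∂P
        = ∫ ω, w i ω * w k ω * (z i ω * z k ω) ∂P := by simp_rw [mul_mul_mul_comm]
      _ = (∫ ω, w i ω * w k ω ∂P) * ∫ ω, z i ω * z k ω ∂P :=
          hprod.integral_fun_mul_eq_mul_integral ((hw i).1.mul (hw k).1)
            ((hz.memLp i).1.mul (hz.memLp k).1)
      _ = 0 := by rw [hz.orthogonal hik, mul_zero]

theorem integral_sum_sq_le [Fintype ι] (hz : IsBoundedOrthogonal P z C) :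
    ∫ ω, (∑ i, z i ω) ^ 2 ∂P ≤ Fintype.card ι * C := by
  have hint : ∀ i k, Integrable (fun ω => z i ω * z k ω) P := fun i k =>
    (hz.memLp i).integrable_mul (hz.memLp k)
  calc ∫ ω, (∑ i, z i ω) ^ 2 ∂P
      = ∑ i, ∑ k, ∫ ω, z i ω * z k ω ∂P := by
        simp_rw [sq, Finset.sum_mul_sum]
        rw [integral_finsetSum _ fun i _ => integrable_finsetSum _ fun k _ => hint i k]
        simp_rw [integral_finsetSum _ fun k _ => hint _ k]
    _ = ∑ i, ∫ ω, z i ω ^ 2 ∂P := by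
        refine Finset.sum_congr rfl fun i _ => ?_
        rw [Finset.sum_eq_single i (fun k _ hk => hz.orthogonal hk.symm) (by simp)]
        simp_rw [sq]
    _ ≤ ∑ _i : ι, C := Finset.sum_le_sum fun i _ => hz.integral_sq_le i
    _ = Fintype.card ι * C := by simp

end IsBoundedOrthogonal

theorem indepFun_of_disjoint_range {α β γ : Type*} [Finite α] [Finite β] [MeasurableSpace γ]
    {f : ι → Ω → γ} (h : iIndepFun f P) (hf : ∀ i, AEMeasurable (f i) P) {a : α → ι} {b : β → ι}
    (hab : ∀ i k, a i ≠ b k) :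
    IndepFun (fun ω i => f (a i) ω) (fun ω i => f (b i) ω) P := by
  classical
  have := Fintype.ofFinite α
  have := Fintype.ofFinite β
  have hdisj : Disjoint (Finset.univ.image a) (Finset.univ.image b) := by
    simp only [Finset.disjoint_left, Finset.mem_image, Finset.mem_univ, true_and, not_exists]
    rintro _ ⟨i, rfl⟩ k
    exact (hab i k).symm
  exact (h.indepFun_finset₀ _ _ hdisj hf).comp
    (φ := fun v i => v ⟨a i, Finset.mem_image_of_mem a (Finset.mem_univ i)⟩)
    (ψ := fun v i => v ⟨b i, Finset.mem_image_of_mem b (Finset.mem_univ i)⟩)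
    (by fun_prop) (by fun_prop)

end Orthogonal

section RowSums

variable {Ω : Type*} [MeasurableSpace Ω] {P : Measure Ω} {z w : (n : ℕ) → Fin n → Ω → ℝ}

/-- The row sums of the triangular array `z` are `O_P(√n)`. -/
def RootNBounded (P : Measure Ω) (z : (n : ℕ) → Fin n → Ω → ℝ) : Prop :=
  BoundedInProbability P atTop fun (n : ℕ) ω => (√(n : ℝ))⁻¹ * ∑ i, z n i ω

namespace RootNBounded

theorem congr (hz : RootNBounded P z) (h : ∀ n i ω, z n i ω = w n i ω) : RootNBounded P w := by
  simpa only [RootNBounded, h] using hz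

theorem add (hz : RootNBounded P z) (hw : RootNBounded P w) :
    RootNBounded P fun n i ω => z n i ω + w n i ω := by
  simpa only [RootNBounded, Finset.sum_add_distrib, mul_add] using BoundedInProbability.add hz hw

theorem const_mul (hz : RootNBounded P z) (c : ℝ) : RootNBounded P fun n i ω => c * z n i ω := by
  simpa only [RootNBounded, ← Finset.mul_sum, mul_left_comm c] using
    BoundedInProbability.const_mul hz c

theorem sum {κ : Type*} (s : Finset κ) {f : κ → (n : ℕ) → Fin n → Ω → ℝ}
    (h : ∀ k ∈ s, RootNBounded P (f k)) : RootNBounded P fun n i ω => ∑ k ∈ s, f k n i ω := by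
  simpa only [RootNBounded, Finset.sum_comm (t := s), Finset.mul_sum] using
    BoundedInProbability.sum s h

theorem of_isBoundedOrthogonal [IsFiniteMeasure P] {C : ℝ}
    (hz : ∀ n, IsBoundedOrthogonal P (z n) C) : RootNBounded P z := by
  refine BoundedInProbability.of_integral_norm_sq_le (C := C) (fun n => ?_) ?_
  · exact ((memLp_finsetSum _ fun i _ => (hz n).memLp i).const_mul _).norm.integrable_sq
  · filter_upwards [eventually_gt_atTop 0] with n hn
    have hn' : (0 : ℝ) < n := Nat.cast_pos.2 hn
    simp only [norm_mul, mul_pow, norm_inv, inv_pow, Real.norm_eq_abs, sq_abs,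
      Real.sq_sqrt hn'.le]
    rw [integral_const_mul, inv_mul_le_iff₀ hn']
    simpa only [Fintype.card_fin] using (hz n).integral_sum_sq_le

theorem tendsto_average (hz : RootNBounded P z) :
    Tendsto (fun y : ℕ × Ω => (y.1 : ℝ)⁻¹ * ∑ i, z y.1 i y.2) (highProbability P atTop) (𝓝 0) := by
  have hzero : Tendsto (fun y : ℕ × Ω => (√(y.1 : ℝ))⁻¹) (highProbability P atTop) (𝓝 0) :=
    tendsto_inv_sqrt_natCast.comp tendsto_fst_highProbability
  refine BoundedInProbability.tendsto_zero_of_norm_le_mul (f := fun (n : ℕ) _ => (√(n : ℝ))⁻¹)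
    (h := fun n ω => (n : ℝ)⁻¹ * ∑ i, z n i ω) hz hzero fun n ω => ?_
  rw [← norm_mul, ← mul_assoc, ← mul_inv, Real.mul_self_sqrt n.cast_nonneg]

end RootNBounded

end RowSums

section IndependentArray

variable {Ω ι : Type*} [MeasurableSpace Ω] {P : Measure Ω} {x : ℕ → ι → Ω → ℝ} {X : ι → Ω → ℝ}

/-- An array `x i j` of independent centred square-integrable random variables in which every entry
of the column `j` is distributed as `X j`: the covariates of the units `i = 0, 1, …`. -/
structure IsIndependentArray (P : Measure Ω) (x : ℕ → ι → Ω → ℝ) (X : ι → Ω → ℝ) : Prop where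
  identDistrib : ∀ i j, IdentDistrib (x i j) (X j) P P
  indep : iIndepFun (fun k : ℕ × ι => x k.1 k.2) P
  memLp : ∀ j, MemLp (X j) 2 P
  integral_eq_zero : ∀ j, ∫ ω, X j ω ∂P = 0

namespace IsIndependentArray

theorem indepFun_rows (h : IsIndependentArray P x X) (j : ι) :
    Pairwise fun i k => IndepFun (x i j) (x k j) P := fun i k hik =>
  h.indep.indepFun (i := (i, j)) (j := (k, j)) fun heq => hik (congrArg Prod.fst heq)

theorem indepFun_columns (h : IsIndependentArray P x X) (n : ℕ) {j k : ι} (hjk : j ≠ k) :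
    IndepFun (fun ω (i : Fin n) => x i j ω) (fun ω (i : Fin n) => x i k ω) P :=
  indepFun_of_disjoint_range (a := fun i : Fin n => ((i : ℕ), j))
    (b := fun i : Fin n => ((i : ℕ), k)) h.indep
    (fun i => (h.identDistrib i.1 i.2).aemeasurable_fst) fun _ _ heq => hjk (congrArg Prod.snd heq)

theorem isBoundedOrthogonal_column (h : IsIndependentArray P x X) (j : ι) (n : ℕ) :
    IsBoundedOrthogonal P (fun i : Fin n => x i j) (variance (X j) P) :=
  (IsBoundedOrthogonal.of_identDistrib (h.indepFun_rows j) (fun i => h.identDistrib i j)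
    (h.memLp j) (h.integral_eq_zero j)).comp_injective Fin.val_injective

theorem rootNBounded [IsFiniteMeasure P] (h : IsIndependentArray P x X) (j : ι) :
    RootNBounded P fun _ i ω => x i j ω :=
  .of_isBoundedOrthogonal (h.isBoundedOrthogonal_column j)

theorem rootNBounded_mul [IsFiniteMeasure P] (h : IsIndependentArray P x X) {j k : ι}
    (hjk : j ≠ k) : RootNBounded P fun _ i ω => x i j ω * x i k ω :=
  .of_isBoundedOrthogonal fun n => (h.isBoundedOrthogonal_column k n).mul_of_indepFun
    (h.isBoundedOrthogonal_column j n).memLp (h.isBoundedOrthogonal_column j n).integral_sq_le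
    (h.indepFun_columns n hjk.symm)

theorem tendsto_average_sq [IsFiniteMeasure P] (h : IsIndependentArray P x X) (j : ι) :
    Tendsto (fun z : ℕ × Ω => (z.1 : ℝ)⁻¹ * ∑ i : Fin z.1, x i j z.2 ^ 2)
      (highProbability P atTop) (𝓝 (variance (X j) P)) := by
  rw [variance_of_integral_eq_zero (h.memLp j).1.aemeasurable (h.integral_eq_zero j)]
  have hindep : Pairwise fun i k => IndepFun (fun ω => x i j ω ^ 2) (fun ω => x k j ω ^ 2) P :=
    fun i k hik => (h.indepFun_rows j hik).comp (φ := fun y : ℝ => y ^ 2) (ψ := fun y : ℝ => y ^ 2)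
      (measurable_id.pow_const 2) (measurable_id.pow_const 2)
  have hident : ∀ i, IdentDistrib (fun ω => x i j ω ^ 2) (fun ω => X j ω ^ 2) P P := fun i =>
    (h.identDistrib i j).sq
  have hlln := tendstoInMeasure_const_iff.1
    (tendstoInMeasure_average (h.memLp j).integrable_sq hident hindep)
  exact hlln

end IsIndependentArray

end IndependentArray

section WorkingModel

variable {Ω : Type*} {p q : ℕ} {T : (n : ℕ) → Fin n → Ω → ℝ} {x : ℕ → Fin (p + q) → Ω → ℝ}

theorem outcome_eq_linearModel (μ₁ μ₂ : ℝ) (β : Fin (p + q) → ℝ)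
    (T : (n : ℕ) → Fin n → Ω → ℝ) (x : ℕ → Fin (p + q) → Ω → ℝ) (ε : ℕ → Ω → ℝ) (n : ℕ) (ω : Ω) :
    outcome μ₁ μ₂ β T x ε n ω = designMatrix T x n ω *ᵥ workingParameter μ₁ μ₂ β +
      (excludedCovariates x n ω *ᵥ excludedCoefficients β + fun i : Fin n => ε i ω) := by
  ext i
  simp only [outcome, designMatrix, workingParameter, excludedCovariates, excludedCoefficients,
    Matrix.mulVec, dotProduct, Pi.add_apply, Matrix.of_apply, Fintype.sum_sum_type, Sum.elim_inl,
    Sum.elim_inr, Fin.sum_univ_two, Fin.sum_univ_add, Matrix.cons_val_zero, Matrix.cons_val_one]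
  simp only [mul_comm (β _)]
  ring

theorem norm_designMatrix_inl_le {n : ℕ} {i : Fin n} {ω : Ω}
    (hT : T n i ω = 0 ∨ T n i ω = 1) (a : Fin 2) : ‖designMatrix T x n ω i (Sum.inl a)‖ ≤ 1 := by
  fin_cases a <;> rcases hT with h | h <;> simp [designMatrix, h]

theorem designMatrix_inl_mul_inl {n : ℕ} {i : Fin n} {ω : Ω}
    (hT : T n i ω = 0 ∨ T n i ω = 1) (a b : Fin 2) :
    designMatrix T x n ω i (Sum.inl a) * designMatrix T x n ω i (Sum.inl b) =
      if a = b then designMatrix T x n ω i (Sum.inl a) else 0 := by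
  fin_cases a <;> fin_cases b <;> rcases hT with h | h <;> simp [designMatrix, h]

variable [MeasurableSpace Ω] {P : Measure Ω} {X : Fin (p + q) → Ω → ℝ} {ε : ℕ → Ω → ℝ} {C : ℝ}

theorem isUnit_limitMatrix (hX_var : ∀ j : Fin p, 0 < variance (X (Fin.castAdd q j)) P) :
    IsUnit (limitMatrix P X) := by
  refine Matrix.isUnit_diagonal.2 (Pi.isUnit_iff.2 ?_)
  rintro (_ | j)
  · exact (one_half_pos (α := ℝ)).ne'.isUnit
  · exact (hX_var j).ne'.isUnit

theorem tendsto_average_of_two_mul_sub_one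
    (h : Tendsto (fun z : ℕ × Ω => (z.1 : ℝ)⁻¹ * ∑ i : Fin z.1, (2 * T z.1 i z.2 - 1))
      (highProbability P atTop) (𝓝 0)) :
    Tendsto (fun z : ℕ × Ω => (z.1 : ℝ)⁻¹ * ∑ i : Fin z.1, T z.1 i z.2)
      (highProbability P atTop) (𝓝 (1 / 2)) := by
  have hhalf := (h.add_const 1).div_const 2
  rw [zero_add] at hhalf
  refine hhalf.congr' ?_
  filter_upwards [tendsto_fst_highProbability.eventually (eventually_ne_atTop 0)] with z hz
  have hz' : (z.1 : ℝ) ≠ 0 := Nat.cast_ne_zero.2 hz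
  rw [Finset.sum_sub_distrib, ← Finset.mul_sum, Fin.sum_const, nsmul_one]
  field_simp
  ring

theorem tendsto_average_designMatrix_inl
    (hglobal : Tendsto (fun z : ℕ × Ω => (z.1 : ℝ)⁻¹ * ∑ i : Fin z.1, (2 * T z.1 i z.2 - 1))
      (highProbability P atTop) (𝓝 0)) (a : Fin 2) :
    Tendsto (fun z : ℕ × Ω =>
        (z.1 : ℝ)⁻¹ * ∑ i : Fin z.1, designMatrix T x z.1 z.2 i (Sum.inl a))
      (highProbability P atTop) (𝓝 (1 / 2)) := by
  fin_cases a
  · exact tendsto_average_of_two_mul_sub_one hglobal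
  · refine tendsto_average_of_two_mul_sub_one (T := fun n i ω => 1 - T n i ω) ?_
    rw [← neg_zero]
    refine hglobal.neg.congr fun z => ?_
    rw [← mul_neg, ← Finset.sum_neg_distrib]
    exact congrArg _ (Finset.sum_congr rfl fun i _ => by ring)

theorem rootNBounded_designMatrix_inl_mul {y : (n : ℕ) → Fin n → Ω → ℝ}
    (hbal : RootNBounded P fun n i ω => (2 * T n i ω - 1) * y n i ω) (hy : RootNBounded P y)
    (a : Fin 2) : RootNBounded P fun n i ω => designMatrix T x n ω i (Sum.inl a) * y n i ω := by
  have htreated : RootNBounded P fun n i ω => T n i ω * y n i ω := by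
    refine .congr ((hbal.add hy).const_mul 2⁻¹) fun n i ω => ?_
    ring
  fin_cases a
  · exact htreated
  · have hcontrol : RootNBounded P fun n i ω => (1 - T n i ω) * y n i ω := by
      refine .congr (hy.add (htreated.const_mul (-1))) fun n i ω => ?_
      ring
    exact hcontrol

theorem rootNBounded_designMatrix_mul_covariate [IsFiniteMeasure P]
    (hx : IsIndependentArray P x X)
    (hbal : ∀ j, RootNBounded P fun n i ω => (2 * T n i ω - 1) * x i j ω)
    {a : Fin 2 ⊕ Fin p} {k : Fin (p + q)} (hak : ∀ j, a = Sum.inr j → Fin.castAdd q j ≠ k) :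
    RootNBounded P fun n i ω => designMatrix T x n ω i a * x i k ω := by
  rcases a with a | j
  · exact rootNBounded_designMatrix_inl_mul (hbal k) (hx.rootNBounded k) a
  · exact hx.rootNBounded_mul (hak j rfl)

theorem rootNBounded_mul_error [IsFiniteMeasure P] (hε : IsBoundedOrthogonal P ε C)
    {w : (n : ℕ) → Fin n → Ω → ℝ} {D : ℝ} (hw : ∀ n i, MemLp (w n i) 2 P)
    (hw_sq : ∀ n i, ∫ ω, w n i ω ^ 2 ∂P ≤ D)
    (hindep : ∀ n, IndepFun (fun ω (i : Fin n) => ε i ω) (fun ω i => w n i ω) P) :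
    RootNBounded P fun n i ω => w n i ω * ε i ω :=
  .of_isBoundedOrthogonal fun n =>
    (hε.comp_injective Fin.val_injective).mul_of_indepFun (hw n) (hw_sq n) (hindep n)

theorem rootNBounded_designMatrix_inl_mul_error [IsProbabilityMeasure P]
    (hε : IsBoundedOrthogonal P ε C) (hT_meas : ∀ n i, Measurable (T n i))
    (hT_val : ∀ n i ω, T n i ω = 0 ∨ T n i ω = 1)
    (hεT : ∀ n, IndepFun (fun ω (i : Fin n) => ε i ω) (fun ω i => T n i ω) P) (a : Fin 2) :
    RootNBounded P fun n i ω => designMatrix T x n ω i (Sum.inl a) * ε i ω := by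
  have hcol : Measurable fun t : ℝ => ![t, 1 - t] a := by
    fin_cases a
    · exact measurable_id
    · exact measurable_const.sub measurable_id
  have hmemLp : ∀ n i, MemLp (fun ω => designMatrix T x n ω i (Sum.inl a)) 2 P := fun n i =>
    .of_bound (hcol.comp (hT_meas n i)).aestronglyMeasurable 1
      (.of_forall fun ω => norm_designMatrix_inl_le (hT_val n i ω) a)
  refine rootNBounded_mul_error hε hmemLp (D := 1) (fun n i => ?_) fun n =>
    (hεT n).comp (ψ := fun (v : Fin n → ℝ) i => ![v i, 1 - v i] a) measurable_id
      (measurable_pi_lambda _ fun i => hcol.comp (measurable_pi_apply i))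
  calc ∫ ω, designMatrix T x n ω i (Sum.inl a) ^ 2 ∂P
      ≤ ∫ _, 1 ∂P := integral_mono (hmemLp n i).integrable_sq (integrable_const 1) fun ω =>
        (sq_le_one_iff_abs_le_one _).2 (norm_designMatrix_inl_le (hT_val n i ω) a)
    _ = 1 := by simp

theorem rootNBounded_designMatrix_mul_error [IsProbabilityMeasure P]
    (hx : IsIndependentArray P x X) (hε : IsBoundedOrthogonal P ε C)
    (hT_meas : ∀ n i, Measurable (T n i)) (hT_val : ∀ n i ω, T n i ω = 0 ∨ T n i ω = 1)
    (hεx : IndepFun (fun ω i => ε i ω) (fun ω i j => x i j ω) P)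
    (hεT : ∀ n, IndepFun (fun ω (i : Fin n) => ε i ω) (fun ω i => T n i ω) P)
    (a : Fin 2 ⊕ Fin p) : RootNBounded P fun n i ω => designMatrix T x n ω i a * ε i ω := by
  rcases a with a | j
  · exact rootNBounded_designMatrix_inl_mul_error hε hT_meas hT_val hεT a
  · have hcol := hx.isBoundedOrthogonal_column (Fin.castAdd q j)
    exact rootNBounded_mul_error hε (fun n => (hcol n).memLp) (fun n => (hcol n).integral_sq_le)
      fun n => hεx.comp (φ := fun (v : ℕ → ℝ) (i : Fin n) => v i)
        (ψ := fun (v : ℕ → Fin (p + q) → ℝ) (i : Fin n) => v i (Fin.castAdd q j))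
        (by fun_prop) (by fun_prop)

theorem tendsto_gram_covariate [IsFiniteMeasure P] (hx : IsIndependentArray P x X)
    (hbal : ∀ j, RootNBounded P fun n i ω => (2 * T n i ω - 1) * x i j ω)
    (a : Fin 2 ⊕ Fin p) (k : Fin p) :
    Tendsto (fun z : ℕ × Ω =>
        (z.1 : ℝ)⁻¹ * ∑ i : Fin z.1, designMatrix T x z.1 z.2 i a * x i (Fin.castAdd q k) z.2)
      (highProbability P atTop) (𝓝 (limitMatrix P X a (Sum.inr k))) := by
  rcases eq_or_ne a (Sum.inr k) with rfl | hak
  · rw [limitMatrix, Matrix.diagonal_apply_eq]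
    refine (hx.tendsto_average_sq (Fin.castAdd q k)).congr fun z => ?_
    simp only [sq]
    rfl
  · rw [limitMatrix, Matrix.diagonal_apply_ne _ hak]
    refine (rootNBounded_designMatrix_mul_covariate hx hbal ?_).tendsto_average
    rintro j rfl hjk
    exact hak (congrArg Sum.inr (Fin.castAdd_injective p q hjk))

theorem tendsto_gram_designMatrix [IsFiniteMeasure P] (hx : IsIndependentArray P x X)
    (hT_val : ∀ n i ω, T n i ω = 0 ∨ T n i ω = 1)
    (hglobal : Tendsto (fun z : ℕ × Ω => (z.1 : ℝ)⁻¹ * ∑ i : Fin z.1, (2 * T z.1 i z.2 - 1))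
      (highProbability P atTop) (𝓝 0))
    (hbal : ∀ j, RootNBounded P fun n i ω => (2 * T n i ω - 1) * x i j ω) :
    Tendsto (fun z : ℕ × Ω =>
        (z.1 : ℝ)⁻¹ • ((designMatrix T x z.1 z.2)ᵀ * designMatrix T x z.1 z.2))
      (highProbability P atTop) (𝓝 (limitMatrix P X)) := by
  refine tendsto_pi_nhds.2 fun a => tendsto_pi_nhds.2 fun b => ?_
  simp only [Matrix.smul_apply, Matrix.mul_apply, Matrix.transpose_apply, smul_eq_mul]
  rcases b with b | k
  · rcases a with a | j
    · simp only [designMatrix_inl_mul_inl (hT_val _ _ _), limitMatrix, Matrix.diagonal_apply,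
        Sum.inl.injEq, Sum.elim_inl]
      split_ifs with hab
      · exact tendsto_average_designMatrix_inl hglobal a
      · simpa only [Finset.sum_const_zero, mul_zero] using tendsto_const_nhds
    · exact (tendsto_gram_covariate hx hbal (Sum.inl b) j).congr fun z =>
        congrArg _ (Finset.sum_congr rfl fun i _ => mul_comm _ _)
  · exact tendsto_gram_covariate hx hbal a k

theorem boundedInProbability_score [IsProbabilityMeasure P]
    (hx : IsIndependentArray P x X) (hε : IsBoundedOrthogonal P ε C)
    (hT_meas : ∀ n i, Measurable (T n i)) (hT_val : ∀ n i ω, T n i ω = 0 ∨ T n i ω = 1)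
    (hεx : IndepFun (fun ω i => ε i ω) (fun ω i j => x i j ω) P)
    (hεT : ∀ n, IndepFun (fun ω (i : Fin n) => ε i ω) (fun ω i => T n i ω) P)
    (hbal : ∀ j, RootNBounded P fun n i ω => (2 * T n i ω - 1) * x i j ω)
    (β : Fin (p + q) → ℝ) :
    BoundedInProbability P atTop fun (n : ℕ) ω => (√(n : ℝ))⁻¹ • ((designMatrix T x n ω)ᵀ *ᵥ
      (excludedCovariates x n ω *ᵥ excludedCoefficients β + fun i : Fin n => ε i ω)) := by
  refine .pi fun a => ?_
  have hcov : ∀ k : Fin q, RootNBounded P fun n i ω =>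
      designMatrix T x n ω i a * x i (Fin.natAdd p k) ω := fun k =>
    rootNBounded_designMatrix_mul_covariate hx hbal fun j _ =>
      Fin.ne_of_val_ne (by simp only [Fin.val_castAdd, Fin.val_natAdd]; omega)
  refine RootNBounded.congr ((RootNBounded.sum Finset.univ fun k _ =>
    (hcov k).const_mul (β (Fin.natAdd p k))).add
      (rootNBounded_designMatrix_mul_error hx hε hT_meas hT_val hεx hεT a)) fun n i ω => ?_
  simp only [Matrix.mulVec, dotProduct, Matrix.transpose_apply, Pi.add_apply, excludedCovariates,
    excludedCoefficients, Matrix.of_apply, mul_add, Finset.mul_sum]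
  exact congrArg (· + _) (Finset.sum_congr rfl fun k _ => by ring)

end WorkingModel

theorem theorem3p1_general {Ω : Type*} [MeasurableSpace Ω] (P : Measure Ω) [IsProbabilityMeasure P]
    (p q : ℕ) (μ₁ μ₂ : ℝ) (β : Fin (p + q) → ℝ)
    (X : Fin (p + q) → Ω → ℝ) (x : ℕ → Fin (p + q) → Ω → ℝ) (hx : IsIndependentArray P x X)
    (hX_var : ∀ j : Fin p, 0 < variance (X (Fin.castAdd q j)) P)
    (ε : ℕ → Ω → ℝ) {C : ℝ} (hε : IsBoundedOrthogonal P ε C)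
    (T : (n : ℕ) → Fin n → Ω → ℝ) (hT_meas : ∀ n i, Measurable (T n i))
    (hT_val : ∀ n i ω, T n i ω = 0 ∨ T n i ω = 1)
    (hεx : IndepFun (fun ω i => ε i ω) (fun ω i j => x i j ω) P)
    (hεT : ∀ n, IndepFun (fun ω (i : Fin n) => ε i ω) (fun ω i => T n i ω) P)
    (hglobal : TendstoInMeasure P
      (fun (n : ℕ) ω => (n : ℝ)⁻¹ * ∑ i : Fin n, (2 * T n i ω - 1)) atTop (fun _ => 0))
    (hbal : ∀ j, RootNBounded P fun n i ω => (2 * T n i ω - 1) * x i j ω) :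
    Tendsto (fun n : ℕ => P {ω | IsUnit ((designMatrix T x n ω)ᵀ * designMatrix T x n ω)})
      atTop (𝓝 1) ∧
    TendstoInMeasure P
      (fun (n : ℕ) ω => olsEstimate (designMatrix T x n ω) (outcome μ₁ μ₂ β T x ε n ω))
      atTop (fun _ => workingParameter μ₁ μ₂ β) ∧
    TendstoInMeasure P
      (fun (n : ℕ) ω =>
        √(n : ℝ) • (olsEstimate (designMatrix T x n ω) (outcome μ₁ μ₂ β T x ε n ω) -
          workingParameter μ₁ μ₂ β) -
        (√(n : ℝ))⁻¹ • ((limitMatrix P X)⁻¹ *ᵥ ((designMatrix T x n ω)ᵀ *ᵥ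
          (excludedCovariates x n ω *ᵥ excludedCoefficients β + fun i : Fin n => ε i ω))))
      atTop (fun _ => 0) := by
  have hV : IsUnit (limitMatrix P X) := isUnit_limitMatrix hX_var
  have hproportion := tendstoInMeasure_const_iff.1 hglobal
  have hGram := tendsto_gram_designMatrix hx hT_val hproportion hbal
  have hscore := boundedInProbability_score hx hε hT_meas hT_val hεx hεT hbal β
  simp only [olsEstimate, outcome_eq_linearModel]
  refine ⟨tendsto_measure_of_eventually_highProbability ?_, tendstoInMeasure_const_iff.2 ?_,
    tendstoInMeasure_const_iff.2 ?_⟩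
  · exact eventually_isUnit_gram hV hGram
  · exact tendsto_leastSquares hV hGram hscore _
  · exact tendsto_leastSquares_remainder hV hGram hscore _

theorem theorem3p1 {Ω Ω' : Type*} [MeasurableSpace Ω] [MeasurableSpace Ω']
    (P : Measure Ω) [IsProbabilityMeasure P] (P' : Measure Ω') [IsProbabilityMeasure P']
    (p q : ℕ) (μ₁ μ₂ : ℝ) (β : Fin (p + q) → ℝ)
    -- the covariates `x i j`, independent over units `i` and over `j`, distributed as `X j`
    (X : Fin (p + q) → Ω → ℝ) (x : ℕ → Fin (p + q) → Ω → ℝ)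
    (hx_meas : ∀ i j, Measurable (x i j))
    (hx_ident : ∀ i j, IdentDistrib (x i j) (X j) P P)
    (hx_indep : iIndepFun (fun k : ℕ × Fin (p + q) => x k.1 k.2) P)
    (hX_sq : ∀ j, MemLp (X j) 2 P)
    (hX_mean : ∀ j, ∫ ω, X j ω ∂P = 0)
    (hX_var : ∀ j : Fin p, 0 < variance (X (Fin.castAdd q j)) P)
    -- the random errors, i.i.d. with mean zero and finite variance
    (ε : ℕ → Ω → ℝ)
    (hε_meas : ∀ i, Measurable (ε i))
    (hε_ident : ∀ i, IdentDistrib (ε i) (ε 0) P P)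
    (hε_indep : iIndepFun ε P)
    (hε_sq : MemLp (ε 0) 2 P)
    (hε_mean : ∫ ω, ε 0 ω ∂P = 0)
    -- the assignment `T n i` of the `i`-th unit in the experiment with `n` units
    (T : (n : ℕ) → Fin n → Ω → ℝ)
    (hT_meas : ∀ n i, Measurable (T n i))
    (hT_val : ∀ n i ω, T n i ω = 0 ∨ T n i ω = 1)
    -- the errors are independent of the covariates, and of the assignments
    (hεx : IndepFun (fun ω i => ε i ω) (fun ω i j => x i j ω) P)
    (hεT : ∀ n, IndepFun (fun ω (i : Fin n) => ε i ω) (fun ω i => T n i ω) P)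
    -- global balance
    (hglobal : TendstoInMeasure P
      (fun (n : ℕ) ω => (n : ℝ)⁻¹ * ∑ i : Fin n, (2 * T n i ω - 1)) atTop (fun _ => 0))
    -- covariate balance
    (ξ : Ω' → Fin (p + q) → ℝ)
    (hξ_int : ∀ j, Integrable (fun ω => ξ ω j) P')
    (hξ_mean : ∀ j, ∫ ω, ξ ω j ∂P' = 0)
    (hbalance : TendstoInDistribution
      (fun (n : ℕ) ω (j : Fin (p + q)) =>
        (√(n : ℝ))⁻¹ * ∑ i : Fin n, (2 * T n i ω - 1) * x i j ω)
      atTop ξ (fun _ => P) P') :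
    -- the estimate is well defined with probability tending to one
    Tendsto (fun n : ℕ => P {ω | IsUnit ((designMatrix T x n ω)ᵀ * designMatrix T x n ω)})
      atTop (𝓝 1) ∧
    -- consistency
    TendstoInMeasure P
      (fun (n : ℕ) ω => olsEstimate (designMatrix T x n ω) (outcome μ₁ μ₂ β T x ε n ω))
      atTop (fun _ => workingParameter μ₁ μ₂ β) ∧
    -- the asymptotic representation, with a remainder that tends to zero in probability
    TendstoInMeasure P
      (fun (n : ℕ) ω =>
        √(n : ℝ) • (olsEstimate (designMatrix T x n ω) (outcome μ₁ μ₂ β T x ε n ω) -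
          workingParameter μ₁ μ₂ β) -
        (√(n : ℝ))⁻¹ • ((limitMatrix P X)⁻¹ *ᵥ ((designMatrix T x n ω)ᵀ *ᵥ
          (excludedCovariates x n ω *ᵥ excludedCoefficients β + fun i : Fin n => ε i ω))))
      atTop (fun _ => 0) := by
  exact theorem3p1_general P p q μ₁ μ₂ β X x ⟨hx_ident, hx_indep, hX_sq, hX_mean⟩ hX_var ε
    (.of_identDistrib (fun _ _ h => hε_indep.indepFun h) hε_ident hε_sq hε_mean) T hT_meas hT_val
    hεx hεT hglobal fun j => (BoundedInProbability.of_tendstoInDistribution hbalance).apply j
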